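/- Let $n\ge 1$. Let $\mathcal I_n$ be the $\mathbb F_2$-linear category whose objects are the integer intervals $[a,b]$ with $1\le a\le b\le n$, where $\operatorname{Hom}([a,b],[c,d])=\mathbb F_2$ if $a\le c\le b\le d$ and $\operatorname{Hom}([a,b],[c,d])=0$ otherwise, and where the composite of the non-zero morphisms $x\to y$ and $y\to z$ is the non-zero morphism $x\to z$ if one exists and is zero otherwise. Let $\mathcal A_n$ be the category whose objects are the finite multisets $\bigoplus_i x_i$ of intervals in $\mathcal I_n$, with $\operatorname{Hom}(\bigoplus_i x_i,\bigoplus_j y_j)=\bigoplus_{i,j}\operatorname{Hom}_{\mathcal I_n}(x_i,y_j)$ and composition given by the matrix product. This is an abelian category. Let $x=[a,b]$ and $x'=[a',b']$ be intervals in $\mathcal I_n$. There is a non-zero element $\eta\in\operatorname{Ext}^1_{\mathcal A_n}(x',x)$ if and only if $$a<a',\qquad b<b'\qquad\text{and}\qquad a'\le b+1 .$$ In this case the non-zero element $\eta$ is unique, and it is the class of a short exact sequence $$0\longrightarrow x\longrightarrow [a,b']\oplus[a',b]\longrightarrow x'\longrightarrow 0,$$ with the convention $[b+1,b]=0$. 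-/

import Mathlib

open CategoryTheory CategoryTheory.Limits

/-- An interval `[a,b]` of integers with `1 ≤ a ≤ b ≤ n`. -/
@[ext]
structure FinInterval (n : ℕ) where
  a : ℕ
  b : ℕ
  one_le : 1 ≤ a
  a_le_b : a ≤ b
  b_le : b ≤ n
  deriving DecidableEq

namespace FinInterval

variable {n : ℕ}

/-- The condition under which there is a non-zero morphism `x ⟶ y`. -/
def HomCond (x y : FinInterval n) : Prop := x.a ≤ y.a ∧ y.a ≤ x.b ∧ x.b ≤ y.b

instance (x y : FinInterval n) : Decidable (x.HomCond y) :=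
  inferInstanceAs (Decidable (_ ∧ _ ∧ _))

/-- The `𝔽₂`-vector space which is `𝔽₂` if `p` holds and `{0}` otherwise. -/
def line (p : Prop) : Submodule (ZMod 2) (ZMod 2) where
  carrier := {r | r ≠ 0 → p}
  add_mem' {r s} hr hs h := by
    by_cases h0 : r = 0
    · exact hs (by simpa [h0] using h)
    · exact hr h0
  zero_mem' h := absurd rfl h
  smul_mem' c r hr h := hr (by rintro rfl; simp at h)

theorem line_eq_zero {p : Prop} (hp : ¬ p) (r : line p) : (r : ZMod 2) = 0 := by
  by_contra h
  exact hp (r.2 h)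

/-- The category of intervals of type `n`: `Hom(x, y)` is `𝔽₂` if
`x.a ≤ y.a ≤ x.b ≤ y.b` and zero otherwise. The composite of the non-zero morphisms `x ⟶ y` and
`y ⟶ z` is the non-zero morphism `x ⟶ z` if there is one, and zero otherwise. -/
noncomputable instance : Category (FinInterval n) where
  Hom x y := line (x.HomCond y)
  id x := ⟨1, fun _ => ⟨le_rfl, x.a_le_b, le_rfl⟩⟩
  comp {x y z} f g := ⟨if x.HomCond z then (f : ZMod 2) * g else 0, fun h => by
    by_contra h'; simp [h'] at h⟩
  id_comp {x y} f := Subtype.ext <| by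
    by_cases h : x.HomCond y
    · simp [h]
    · simp [h, line_eq_zero h f]
  comp_id {x y} f := Subtype.ext <| by
    by_cases h : x.HomCond y
    · simp [h]
    · simp [h, line_eq_zero h f]
  assoc {x y z w} f g h := Subtype.ext <| by
    by_cases hf : x.HomCond y
    swap; · simp [line_eq_zero hf f]
    by_cases hg : y.HomCond z
    swap; · simp [line_eq_zero hg g]
    by_cases hh : z.HomCond w
    swap; · simp [line_eq_zero hh h]
    by_cases hw : x.HomCond w
    swap; · simp only [hw, if_false]
    have h1 : x.HomCond z := by unfold HomCond at *; omega
    have h2 : y.HomCond w := by unfold HomCond at *; omega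
    simp only [hw, h1, h2, if_true, mul_assoc]

noncomputable instance (x y : FinInterval n) : AddCommGroup (x ⟶ y) :=
  inferInstanceAs (AddCommGroup (line (x.HomCond y)))

/-- The scalar in `𝔽₂` underlying a morphism. -/
def coef {x y : FinInterval n} (f : x ⟶ y) : ZMod 2 := Subtype.val (p := fun r => r ∈ line _) f

theorem coef_ext {x y : FinInterval n} {f g : x ⟶ y} (h : coef f = coef g) : f = g :=
  Subtype.ext h

theorem coef_comp {x y z : FinInterval n} (f : x ⟶ y) (g : y ⟶ z) :
    coef (f ≫ g) = if x.HomCond z then coef f * coef g else 0 := rfl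

theorem coef_id (x : FinInterval n) : coef (𝟙 x) = 1 := rfl

theorem coef_add {x y : FinInterval n} (f g : x ⟶ y) : coef (f + g) = coef f + coef g := rfl

theorem coef_ne_zero {x y : FinInterval n} {f : x ⟶ y} (h : coef f ≠ 0) : x.HomCond y :=
  Subtype.prop (p := fun r => r ∈ line _) f h

noncomputable instance : Preadditive (FinInterval n) where
  add_comp x y z f f' g := coef_ext <| by
    simp only [coef_comp, coef_add]; split_ifs <;> ring
  comp_add x y z f g g' := coef_ext <| by
    simp only [coef_comp, coef_add]; split_ifs <;> ring

end FinInterval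

/-- The interval that is listed at the index `k` of a multiset (equal intervals in the multiset
have different indices). -/
def IntervalMultiset.summand {n : ℕ} {m : Multiset (FinInterval n)} (k : m.ToType) : FinInterval n := k.1

/-- The finite family of intervals that underlies a multiset. Morphisms in `Mat_` are matrices
of morphisms between the members of the families, and composition is the matrix product. -/
noncomputable abbrev IntervalMultiset.toMat {n : ℕ} (m : Multiset (FinInterval n)) : Mat_ (FinInterval n) where
  ι := m.ToType
  X k := IntervalMultiset.summand k

/-- The category of multisets of intervals of type `n`: an object is a finite multiset of
intervals, and a morphism `⊕ xᵢ ⟶ ⊕ yⱼ` is a matrix of morphisms `xᵢ ⟶ yⱼ`. -/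
abbrev IntervalMultiset (n : ℕ) := InducedCategory (Mat_ (FinInterval n)) (IntervalMultiset.toMat (n := n))

/-! The rest of the development shows that the category of multisets of intervals is abelian,
via an equivalence with the contravariant finite-dimensional representations over `𝔽₂` of a chain
with `n` vertices. -/

/-- Contravariant finite-dimensional `𝔽₂`-representations of a chain with `n` vertices. -/
abbrev ChainRep (n : ℕ) := (Fin n)ᵒᵖ ⥤ FGModuleCat.{0} (ZMod 2)

namespace FinInterval
variable {n : ℕ}
/-- Multiplication by a scalar, truncated to zero where the target vanishes. -/
def scal (p q : Prop) [Decidable q] (c : ZMod 2) : line p →ₗ[ZMod 2] line q where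
  toFun r := ⟨if q then c * r else 0, fun h => by by_contra h'; simp [h'] at h⟩
  map_add' r s := Subtype.ext <| by dsimp; split_ifs <;> simp [mul_add]
  map_smul' d r := Subtype.ext <| by dsimp; split_ifs <;> simp [mul_left_comm]

theorem scal_coe (p q : Prop) [Decidable q] (c : ZMod 2) (r : line p) :
   (scal p q c r : ZMod 2) = if q then c * r else 0 := rfl

theorem scal_id (p : Prop) [Decidable p] : scal p p 1 = LinearMap.id := by
  ext r
  by_cases h : p
  · simp [scal_coe, h]
  · simp [line_eq_zero h]

theorem scal_add (p q : Prop) [Decidable q] (c d : ZMod 2) :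
    scal p q (c + d) = scal p q c + scal p q d := by
  ext r
  by_cases h : q <;> simp [scal_coe, h, add_mul]

theorem scal_comp (p q s : Prop) [Decidable q] [Decidable s] (c d : ZMod 2)
    (h : c ≠ 0 → d ≠ 0 → p → s → q) :
    scal q s d ∘ₗ scal p q c = scal p s (c * d) := by
  ext r
  simp only [LinearMap.comp_apply, scal_coe]
  by_cases hp : p
  swap; · simp [line_eq_zero hp]
  by_cases hs : s
  swap; · simp [hs]
  by_cases hc : c = 0
  · simp [hc]
  by_cases hd : d = 0
  · simp [hd]
  simp only [hs, h hc hd hp hs, if_true]; ring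

/-- `k : Fin n` stands for the vertex `k + 1`. -/
def Mem (x : FinInterval n) (k : Fin n) : Prop := x.a ≤ k + 1 ∧ k + 1 ≤ x.b

instance (x : FinInterval n) (k : Fin n) : Decidable (x.Mem k) :=
  inferInstanceAs (Decidable (_ ∧ _))

/-- The interval representation of `x`. -/
def toRepObj (x : FinInterval n) : ChainRep n where
  obj k := FGModuleCat.of (ZMod 2) (line (x.Mem k.unop))
  map {k l} _ := FGModuleCat.ofHom (scal _ _ 1)
  map_id k := by rw [scal_id]; rfl
  map_comp {k l m} f g := by
    refine Eq.trans ?_ (congrArg FGModuleCat.ofHom (scal_comp _ _ _ 1 1 ?_).symm)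
    · rw [mul_one]
    · have h1 := leOfHom f.unop
      have h2 := leOfHom g.unop
      rw [Fin.le_def] at h1 h2
      unfold Mem; omega

/-- Interval representations, as a functor. -/
def toRep : FinInterval n ⥤ ChainRep n where
  obj := toRepObj
  map {x y} f :=
    { app k := FGModuleCat.ofHom (scal (x.Mem k.unop) (y.Mem k.unop) (coef f))
      naturality k l g := by
        have h1 := leOfHom g.unop
        rw [Fin.le_def] at h1
        refine Eq.trans (congrArg FGModuleCat.ofHom (scal_comp _ _ _ 1 (coef f) ?_))
          (congrArg FGModuleCat.ofHom (Eq.trans ?_ (scal_comp _ _ _ (coef f) 1 ?_).symm))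
        · intro _ hf
          replace hf := coef_ne_zero hf
          unfold HomCond at hf; unfold Mem; omega
        · rw [mul_comm]
        · intro hf _
          replace hf := coef_ne_zero hf
          unfold HomCond at hf; unfold Mem; omega }
  map_id x := by
    apply NatTrans.ext
    funext k
    exact congrArg FGModuleCat.ofHom (scal_id _)
  map_comp {x y z} f g := by
    apply NatTrans.ext
    funext k
    refine congrArg FGModuleCat.ofHom (Eq.trans ?_ (scal_comp _ _ _ (coef f) (coef g) ?_).symm)
    · ext r
      rw [coef_comp, scal_coe, scal_coe]
      by_cases hf : coef f = 0
      · simp [hf]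
      by_cases hg : coef g = 0
      · simp [hg]
      by_cases h : x.Mem k.unop
      swap; · simp [line_eq_zero h]
      by_cases h' : z.Mem k.unop
      swap; · simp [h']
      have h1 := coef_ne_zero hf
      have h2 := coef_ne_zero hg
      have h3 : x.HomCond z := by unfold Mem HomCond at *; omega
      simp [h3]
    · intro hf hg
      replace hf := coef_ne_zero hf
      replace hg := coef_ne_zero hg
      unfold HomCond at hf hg; unfold Mem; omega

instance : (toRep (n := n)).Additive where
  map_add {x y f g} := by
    apply NatTrans.ext
    funext k
    exact congrArg FGModuleCat.ofHom (scal_add _ _ _ _)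

/-- The linear map underlying a component of a morphism of representations. -/
def lin {M N : ChainRep n} (f : M ⟶ N) (k : (Fin n)ᵒᵖ) : M.obj k →ₗ[ZMod 2] N.obj k :=
  (f.app k).hom.hom

/-- The linear map underlying a structure map of a representation. -/
def str (M : ChainRep n) {k l : (Fin n)ᵒᵖ} (g : k ⟶ l) : M.obj k →ₗ[ZMod 2] M.obj l :=
  (M.map g).hom.hom

theorem lin_ext {M N : ChainRep n} {f g : M ⟶ N} (h : ∀ k, lin f k = lin g k) : f = g := by
  apply NatTrans.ext
  funext k
  exact FGModuleCat.hom_ext (h k)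

theorem lin_comp {M N L : ChainRep n} (f : M ⟶ N) (g : N ⟶ L) (k) :
    lin (f ≫ g) k = lin g k ∘ₗ lin f k := rfl

theorem lin_id (M : ChainRep n) (k) : lin (𝟙 M) k = LinearMap.id := rfl

theorem lin_zero (M N : ChainRep n) (k) : lin (0 : M ⟶ N) k = 0 := rfl

theorem lin_naturality {M N : ChainRep n} (f : M ⟶ N) {k l} (g : k ⟶ l) :
    lin f l ∘ₗ str M g = str N g ∘ₗ lin f k :=
  congrArg (fun t => t.hom.hom) (f.naturality g)

theorem str_comp (M : ChainRep n) {k l m} (f : k ⟶ l) (g : l ⟶ m) :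
    str M (f ≫ g) = str M g ∘ₗ str M f :=
  congrArg (fun t => t.hom.hom) (M.map_comp f g)

theorem str_id (M : ChainRep n) (k) : str M (𝟙 k) = LinearMap.id :=
  congrArg (fun t => t.hom.hom) (M.map_id k)

def mkHom {M N : ChainRep n} (φ : ∀ k, M.obj k →ₗ[ZMod 2] N.obj k)
    (h : ∀ {k l} (g : k ⟶ l), φ l ∘ₗ str M g = str N g ∘ₗ φ k) : M ⟶ N where
  app k := FGModuleCat.ofHom (φ k)
  naturality _ _ g := FGModuleCat.hom_ext (h g)

theorem lin_mkHom {M N : ChainRep n} (φ : ∀ k, M.obj k →ₗ[ZMod 2] N.obj k) (h) (k) :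
    lin (mkHom φ h) k = φ k := rfl

theorem lin_toRep {x y : FinInterval n} (f : x ⟶ y) (k) :
    lin (toRep.map f) k = scal (x.Mem k.unop) (y.Mem k.unop) (coef f) := rfl

theorem str_toRep (x : FinInterval n) {k l : (Fin n)ᵒᵖ} (g : k ⟶ l) :
    str (toRep.obj x) g = scal (x.Mem k.unop) (x.Mem l.unop) 1 := rfl


/-- The vertex `m`. -/
def vert (m : ℕ) (h1 : 1 ≤ m) (h2 : m ≤ n) : (Fin n)ᵒᵖ := Opposite.op ⟨m - 1, by omega⟩

def arr {k l : (Fin n)ᵒᵖ} (h : l.unop ≤ k.unop) : k ⟶ l := (homOfLE h).op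

/-- The scalar by which a morphism between interval representations acts at a vertex. -/
def entry {x y : FinInterval n} (φ : toRep.obj x ⟶ toRep.obj y) (k : (Fin n)ᵒᵖ) : ZMod 2 :=
  if h : x.Mem k.unop then
    Subtype.val (p := fun r => r ∈ line (y.Mem k.unop)) (lin φ k (⟨1, fun _ => h⟩ : line (x.Mem k.unop)))
  else 0

theorem lin_eq_entry {x y : FinInterval n} (φ : toRep.obj x ⟶ toRep.obj y) (k : (Fin n)ᵒᵖ) :
    lin φ k = scal (x.Mem k.unop) (y.Mem k.unop) (entry φ k) := by
  apply LinearMap.ext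
  intro r
  apply Subtype.ext
  refine Eq.trans ?_ (scal_coe _ _ _ _).symm
  by_cases h : x.Mem k.unop
  · have hr : r = (r.1 : ZMod 2) • (⟨1, fun _ => h⟩ : line (x.Mem k.unop)) := by
      apply Subtype.ext; exact (mul_one _).symm
    have h2 : Subtype.val (p := fun r => r ∈ line (y.Mem k.unop)) (lin φ k r) =
        entry φ k * r.1 := by
      refine (congrArg _ ((congrArg (lin φ k) hr).trans (map_smul (lin φ k) _ _))).trans ?_
      rw [entry, dif_pos h, mul_comm]
      rfl
    split_ifs with h3
    · exact h2
    · exact line_eq_zero h3 _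
  · have hr : r = 0 := Subtype.ext (line_eq_zero h r)
    rw [hr, map_zero]
    exact (show (if y.Mem k.unop then entry φ k * (0 : ZMod 2) else 0) = 0 by simp).symm

theorem entry_eq {x y : FinInterval n} (φ : toRep.obj x ⟶ toRep.obj y) {k l : (Fin n)ᵒᵖ}
    (hk : x.Mem k.unop) (hl : y.Mem l.unop) (h : l.unop ≤ k.unop) : entry φ l = entry φ k := by
  have h1 := LinearMap.congr_fun (lin_naturality φ (arr h)) (⟨1, fun _ => hk⟩ : line (x.Mem k.unop))
  rw [str_toRep, str_toRep, lin_eq_entry, lin_eq_entry] at h1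
  have h2 : (scal (x.Mem l.unop) (y.Mem l.unop) (entry φ l)
      (scal (x.Mem k.unop) (x.Mem l.unop) 1 ⟨1, fun _ => hk⟩)).1 =
      (scal (y.Mem k.unop) (y.Mem l.unop) 1
        (scal (x.Mem k.unop) (y.Mem k.unop) (entry φ k) ⟨1, fun _ => hk⟩)).1 :=
    congrArg Subtype.val h1
  simp only [scal_coe, hl, if_true, mul_one, one_mul] at h2
  have h3 : ¬ x.Mem l.unop → entry φ l = 0 := fun h => dif_neg h
  have h4 : ¬ y.Mem k.unop → entry φ k = 0 := fun h => by
    rw [entry, dif_pos hk]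
    exact line_eq_zero h _
  by_cases h5 : x.Mem l.unop <;> by_cases h6 : y.Mem k.unop <;> simp_all

theorem mem_vert (x : FinInterval n) (m : ℕ) (h1 : 1 ≤ m) (h2 : m ≤ n) :
    x.Mem (vert m h1 h2).unop ↔ x.a ≤ m ∧ m ≤ x.b := by
  unfold Mem vert; dsimp only; omega

theorem vert_val (m : ℕ) (h1 : 1 ≤ m) (h2 : m ≤ n) :
    ((vert m h1 h2).unop : ℕ) = m - 1 := rfl

instance : (toRep (n := n)).Faithful where
  map_injective {x y f g} h := by
    apply coef_ext
    by_cases hxy : x.HomCond y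
    · have hc := hxy
      unfold HomCond at hc
      have hx : x.Mem (vert y.a y.one_le (y.a_le_b.trans y.b_le)).unop := by
        rw [mem_vert]; omega
      have hy : y.Mem (vert y.a y.one_le (y.a_le_b.trans y.b_le)).unop := by
        rw [mem_vert]; have := y.a_le_b; omega
      have h1 := congrArg (fun t => lin t (vert y.a y.one_le (y.a_le_b.trans y.b_le))) h
      simp only [lin_toRep] at h1
      have h2 := congrArg Subtype.val (LinearMap.congr_fun h1 ⟨1, fun _ => hx⟩)
      simpa [scal_coe, hy] using h2
    · have hf : coef f = 0 := by by_contra h; exact hxy (coef_ne_zero h)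
      have hg : coef g = 0 := by by_contra h; exact hxy (coef_ne_zero h)
      rw [hf, hg]

instance : (toRep (n := n)).Full where
  map_surjective {x y} φ := by
    have hya := y.a_le_b.trans y.b_le
    let c : line (x.HomCond y) :=
      ⟨if x.HomCond y then entry φ (vert y.a y.one_le hya) else 0,
        fun h => by by_contra h'; simp [h'] at h⟩
    refine ⟨c, lin_ext fun k => ?_⟩
    rw [lin_toRep, lin_eq_entry]
    have hc : coef (x := x) (y := y) c =
      if x.HomCond y then entry φ (vert y.a y.one_le hya) else 0 := rfl
    rw [hc]
    ext r
    simp only [scal_coe]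
    by_cases hx : x.Mem k.unop
    swap; · simp [line_eq_zero hx]
    by_cases hy : y.Mem k.unop
    swap; · simp [hy]
    simp only [hy, if_true]
    congr 1
    have hx' := hx
    have hy' := hy
    have hk := k.unop.2
    unfold Mem at hx' hy'
    have := y.a_le_b
    have := x.one_le
    have := y.one_le
    by_cases hxy : x.HomCond y
    · rw [if_pos hxy]
      refine entry_eq φ hx ?_ ?_
      · rw [mem_vert]; omega
      · rw [Fin.le_def, vert_val]; omega
    · rw [if_neg hxy]
      unfold HomCond at hxy
      by_cases h1 : y.a < x.a
      · have h2 : ¬ x.Mem (vert (x.a - 1) (n := n) (by omega) (by omega)).unop := by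
          rw [mem_vert]; omega
        rw [← entry_eq φ (l := vert (x.a - 1) (by omega) (by omega)) hx, entry, dif_neg h2]
        · rw [mem_vert]; omega
        · rw [Fin.le_def, vert_val]; omega
      · have hxb := x.b_le
        have h2 : ¬ y.Mem (vert x.b (by omega) hxb).unop := by
          rw [mem_vert]; omega
        have h3 : x.Mem (vert x.b (by omega) hxb).unop := by
          rw [mem_vert]; omega
        rw [entry_eq φ (k := vert x.b (by omega) hxb) h3 hy, entry, dif_pos h3]
        · exact (line_eq_zero h2 _).symm
        · rw [Fin.le_def, vert_val]; omega

/-- A nonzero representation has an interval as a retract. -/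
theorem exists_retract (M : ChainRep n) (k₀ : (Fin n)ᵒᵖ) (h : Nontrivial (M.obj k₀)) :
    ∃ (x : FinInterval n) (i : toRep.obj x ⟶ M) (p : M ⟶ toRep.obj x), i ≫ p = 𝟙 _ := by
  classical
  -- the largest vertex in the support
  obtain ⟨t, ht, htmax⟩ : ∃ t : Fin n, Nontrivial (M.obj (.op t)) ∧
      ∀ j, Nontrivial (M.obj (.op j)) → j ≤ t := by
    obtain ⟨t, ht⟩ := (Set.toFinite {j : Fin n | Nontrivial (M.obj (.op j))}).exists_maximal
      ⟨k₀.unop, h⟩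
    refine ⟨t, ht.1, fun j hj => ?_⟩
    rcases le_total j t with h | h
    · exact h
    · exact ht.2 hj h
  obtain ⟨v, hv⟩ := exists_ne (0 : M.obj (.op t))
  -- the image of `v`
  let w : ∀ j : Fin n, M.obj (.op j) := fun j =>
    if h : j ≤ t then str M (arr (k := .op t) (l := .op j) h) v else 0
  have hwt : w t = v := by
    have : arr (k := Opposite.op t) (l := .op t) le_rfl = 𝟙 _ := Subsingleton.elim _ _
    simp only [w, le_rfl, dif_pos]
    rw [this, str_id]; rfl
  have hw : ∀ {k l : (Fin n)ᵒᵖ} (g : k ⟶ l), k.unop ≤ t → str M g (w k.unop) = w l.unop := by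
    intro k l g hk
    have hl : l.unop ≤ t := (leOfHom g.unop).trans hk
    simp only [w, hk, hl, dif_pos]
    rw [← LinearMap.comp_apply]
    refine (LinearMap.congr_fun (str_comp M _ g).symm v).trans ?_
    congr 1
  obtain ⟨s, hs, hsmin⟩ : ∃ s : Fin n, w s ≠ 0 ∧ ∀ j, w j ≠ 0 → s ≤ j := by
    obtain ⟨s, hs⟩ := (Set.toFinite {j : Fin n | w j ≠ 0}).exists_minimal
      ⟨t, by simpa [hwt] using hv⟩
    refine ⟨s, hs.1, fun j hj => ?_⟩
    rcases le_total s j with h | h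
    · exact h
    · exact hs.2 hj h
  have hst : s ≤ t := hsmin t (by rw [hwt]; exact hv)
  obtain ⟨ψ, hψ⟩ : ∃ ψ : M.obj (.op s) →ₗ[ZMod 2] ZMod 2, ψ (w s) = 1 := by
    have : Fact (Nat.Prime 2) := ⟨Nat.prime_two⟩
    exact Module.Projective.exists_dual_eq_one (ZMod 2) hs
  let x : FinInterval n := ⟨s + 1, t + 1, by omega, by rw [Fin.le_def] at hst; omega, t.2⟩
  have hx : ∀ j : Fin n, x.Mem j ↔ s ≤ j ∧ j ≤ t := by
    intro j
    rw [Fin.le_def, Fin.le_def]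
    simp only [Mem, x]; omega
  let i : toRep.obj x ⟶ M := mkHom
    (fun k => (LinearMap.toSpanSingleton (ZMod 2) _ (w k.unop)) ∘ₗ
      (line (x.Mem k.unop)).subtype) (by
    intro k l g
    apply LinearMap.ext
    intro (r : line (x.Mem k.unop))
    change (scal (x.Mem k.unop) (x.Mem l.unop) 1 r).1 • w l.unop = str M g (r.1 • w k.unop)
    rw [map_smul, scal_coe, one_mul]
    by_cases hk : x.Mem k.unop
    · rw [hw g ((hx _).1 hk).2]
      split_ifs with hl
      · rfl
      · have h0 : w l.unop = 0 := by
          by_contra h0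
          exact hl ((hx _).2 ⟨hsmin _ h0, (leOfHom g.unop).trans ((hx _).1 hk).2⟩)
        rw [h0, smul_zero, smul_zero]
    · rw [line_eq_zero hk]; simp)
  let pk : ∀ k : (Fin n)ᵒᵖ, M.obj k →ₗ[ZMod 2] line (x.Mem k.unop) := fun k =>
    if h : x.Mem k.unop then
      (ψ ∘ₗ str M (arr (k := k) (l := .op s) ((hx _).1 h).1)).codRestrict (line (x.Mem k.unop))
        (fun _ _ => h)
    else 0
  have hpk : ∀ (k : (Fin n)ᵒᵖ) (h : x.Mem k.unop) (m : M.obj k),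
      (pk k m).1 = ψ (str M (arr (k := k) (l := .op s) ((hx _).1 h).1) m) := by
    intro k h m
    simp only [pk, dif_pos h]
    rfl
  let p : M ⟶ toRep.obj x := mkHom pk (by
    intro k l g
    apply LinearMap.ext
    intro m
    apply Subtype.ext
    change (pk l (str M g m)).1 = (scal (x.Mem k.unop) (x.Mem l.unop) 1 (pk k m)).1
    rw [scal_coe, one_mul]
    split_ifs with hl
    · by_cases hk : x.Mem k.unop
      · rw [hpk l hl, hpk k hk]
        congr 1
        exact (LinearMap.congr_fun (str_comp M g _) m).symm
      · have h1 : ¬ Nontrivial (M.obj k) := fun h1 =>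
          hk ((hx _).2 ⟨((hx _).1 hl).1.trans (leOfHom g.unop), htmax _ h1⟩)
        have h2 : Subsingleton (M.obj k) := not_nontrivial_iff_subsingleton.1 h1
        rw [Subsingleton.elim m 0, map_zero, map_zero, map_zero]
        rfl
    · exact line_eq_zero hl _)
  refine ⟨x, i, p, lin_ext fun k => ?_⟩
  apply LinearMap.ext
  intro (r : line (x.Mem k.unop))
  apply Subtype.ext
  change (pk k (r.1 • w k.unop)).1 = r.1
  by_cases hk : x.Mem k.unop
  · rw [hpk k hk, map_smul, map_smul, hw _ ((hx _).1 hk).2, hψ, smul_eq_mul, mul_one]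
  · rw [line_eq_zero hk, line_eq_zero hk]

/-- The total dimension of a representation. -/
noncomputable def dim (M : ChainRep n) : ℕ := ∑ k, Module.finrank (ZMod 2) (M.obj k)

theorem dim_lt {M N : ChainRep n} {x : FinInterval n} (u : N ⟶ M) (s : M ⟶ N) (hus : u ≫ s = 𝟙 N)
    (i : toRep.obj x ⟶ M) (p : M ⟶ toRep.obj x) (hip : i ≫ p = 𝟙 _) (hup : u ≫ p = 0) :
    dim N < dim M := by
  have : Fact (Nat.Prime 2) := ⟨Nat.prime_two⟩
  have hinj : ∀ k, Function.Injective (lin u k) := fun k => by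
    have h := congrArg (fun t => lin t k) hus
    have h' : ∀ m, lin s k (lin u k m) = m := fun m => LinearMap.congr_fun h m
    exact Function.LeftInverse.injective h'
  refine Finset.sum_lt_sum (fun k _ => LinearMap.finrank_le_finrank_of_injective (hinj k)) ?_
  have hb : 1 ≤ x.b := x.one_le.trans x.a_le_b
  refine ⟨vert x.b hb x.b_le, Finset.mem_univ _, ?_⟩
  refine lt_of_le_of_ne (LinearMap.finrank_le_finrank_of_injective (hinj _)) fun h => ?_
  have hsurj := (LinearMap.injective_iff_surjective_of_finrank_eq_finrank h).1 (hinj _)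
  have hx : x.Mem (vert x.b hb x.b_le).unop := by
    rw [mem_vert]; have := x.a_le_b; omega
  generalize vert x.b hb x.b_le = k at *
  let e : line (x.Mem k.unop) := ⟨1, fun _ => hx⟩
  obtain ⟨m, hm⟩ := hsurj (lin i k e)
  have h1 : lin p k (lin u k m) = 0 :=
    LinearMap.congr_fun (congrArg (fun t => lin t k) hup) m
  have h2 : lin p k (lin i k e) = e :=
    LinearMap.congr_fun (congrArg (fun t => lin t k) hip) e
  rw [hm, h2] at h1
  exact one_ne_zero (congrArg Subtype.val h1)

theorem exists_decomp (d : ℕ) (M : ChainRep n) (hM : dim M ≤ d) :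
    ∃ (ι : Type) (_ : Fintype ι) (X : ι → FinInterval n) (u : ∀ j, toRep.obj (X j) ⟶ M)
      (s : ∀ j, M ⟶ toRep.obj (X j)), (∀ j, u j ≫ s j = 𝟙 _) ∧
      (∀ j k, j ≠ k → u j ≫ s k = 0) ∧ ∑ j, s j ≫ u j = 𝟙 M := by
  have : Fact (Nat.Prime 2) := ⟨Nat.prime_two⟩
  induction d generalizing M with
  | zero =>
    refine ⟨Empty, inferInstance, nofun, nofun, nofun, nofun, nofun, ?_⟩
    rw [Finset.univ_eq_empty, Finset.sum_empty]
    refine lin_ext fun k => ?_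
    have h1 : Module.finrank (ZMod 2) (M.obj k) = 0 :=
      Finset.sum_eq_zero_iff.1 (Nat.le_zero.1 hM) k (Finset.mem_univ _)
    have h2 : Subsingleton (M.obj k) := Module.finrank_zero_iff.1 h1
    exact LinearMap.ext fun m => Subsingleton.elim _ _
  | succ d ih =>
    by_cases hd : dim M ≤ d
    · exact ih M hd
    obtain ⟨k₀, hk₀⟩ : ∃ k₀, Nontrivial (M.obj k₀) := by
      by_contra! hc
      apply hd
      have : dim M = 0 := Finset.sum_eq_zero fun k _ => by
        have := hc k
        exact Module.finrank_zero_of_subsingleton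
      omega
    obtain ⟨x, i, p, hip⟩ := exists_retract M k₀ hk₀
    let v := kernel.ι p
    let q : M ⟶ kernel p := kernel.lift p (𝟙 M - p ≫ i) (by simp [hip])
    have hqv : q ≫ v = 𝟙 M - p ≫ i := kernel.lift_ι _ _ _
    have hvp : v ≫ p = 0 := kernel.condition _
    have hvq : v ≫ q = 𝟙 _ := by
      rw [← cancel_mono (kernel.ι p)]
      change (v ≫ q) ≫ v = _
      rw [Category.assoc, hqv, Preadditive.comp_sub, ← Category.assoc v p, hvp]
      simp [v]
    have hiq : i ≫ q = 0 := by
      rw [← cancel_mono (kernel.ι p)]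
      change (i ≫ q) ≫ v = _
      rw [Category.assoc, hqv, Preadditive.comp_sub, ← Category.assoc i p, hip]
      simp
    obtain ⟨ι, _, X, u, s, h1, h2, h3⟩ := ih (kernel p) (by
      have := dim_lt v q hvq i p hip hvp
      omega)
    refine ⟨Option ι, inferInstance, fun o => o.elim x X,
      fun o => match o with | none => i | some j => u j ≫ v,
      fun o => match o with | none => p | some j => q ≫ s j, ?_, ?_, ?_⟩
    · rintro (_ | j)
      · exact hip
      · change (u j ≫ v) ≫ q ≫ s j = _
        rw [Category.assoc, ← Category.assoc v, hvq, Category.id_comp]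
        exact h1 j
    · rintro (_ | j) (_ | k) hjk
      · exact absurd rfl hjk
      · change i ≫ q ≫ s k = 0
        rw [← Category.assoc, hiq, zero_comp]
      · change (u j ≫ v) ≫ p = 0
        rw [Category.assoc, hvp, comp_zero]
      · change (u j ≫ v) ≫ q ≫ s k = _
        rw [Category.assoc, ← Category.assoc v, hvq, Category.id_comp]
        exact h2 j k fun h => hjk (congrArg some h)
    · rw [Fintype.sum_option]
      change p ≫ i + ∑ j, (q ≫ s j) ≫ u j ≫ v = _
      have h4 : ∑ j, (q ≫ s j) ≫ u j ≫ v = q ≫ (∑ j, s j ≫ u j) ≫ v := by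
        simp [Preadditive.comp_sum, Preadditive.sum_comp]
      rw [h4, h3, Category.id_comp, hqv]
      abel

end FinInterval

namespace IntervalMultiset
open FinInterval
variable {n : ℕ}

instance : HasFiniteBiproducts (ChainRep n) := Abelian.hasFiniteBiproducts

/-- The direct sum of the interval representations of a multiset. -/
noncomputable abbrev sumRep (m : Multiset (FinInterval n)) : ChainRep n :=
  ⨁ fun k : m.ToType => FinInterval.toRep.obj (summand k)

/-- The functor sending a multiset of intervals to the sum of its interval representations. -/
noncomputable def toRep : IntervalMultiset n ⥤ ChainRep n where
  obj m := sumRep m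
  map f := biproduct.matrix fun j k => FinInterval.toRep.map (f.hom j k)
  map_id m := by
    classical
    refine biproduct.hom_ext _ _ fun j => biproduct.hom_ext' _ _ fun i => ?_
    rw [biproduct.matrix_π, biproduct.ι_desc, Category.id_comp, biproduct.ι_π]
    change FinInterval.toRep.map ((𝟙 (toMat m) : _ ⟶ _) i j) = _
    rw [Mat_.id_apply]
    split_ifs with h
    · subst h; simp
    · simp
  map_comp {m m' m''} f g := by
    refine biproduct.hom_ext _ _ fun j => biproduct.hom_ext' _ _ fun i => ?_
    rw [Category.assoc, biproduct.matrix_π, biproduct.ι_desc, biproduct.matrix_π,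
      biproduct.ι_matrix_assoc, biproduct.lift_desc]
    change FinInterval.toRep.map ((f.hom ≫ g.hom) i j) = _
    rw [Mat_.comp_apply, Functor.map_sum]
    simp only [Functor.map_comp]

instance : (toRep (n := n)).Faithful where
  map_injective {m m' f g} h := by
    refine InducedCategory.hom_ext (Mat_.hom_ext _ _ fun i j => FinInterval.toRep.map_injective ?_)
    have h1 := congrArg (fun t : sumRep m ⟶ sumRep m' => biproduct.ι _ i ≫ t ≫ biproduct.π _ j) h
    simpa [toRep] using h1

instance : (toRep (n := n)).Full where
  map_surjective {m m'} (φ : sumRep m ⟶ sumRep m') := by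
    refine ⟨InducedCategory.homMk fun i j =>
      FinInterval.toRep.preimage (biproduct.ι (fun k : Multiset.ToType m => FinInterval.toRep.obj (summand k)) i ≫
        φ ≫ biproduct.π (fun k : Multiset.ToType m' => FinInterval.toRep.obj (summand k)) j), ?_⟩
    refine biproduct.hom_ext _ _ fun j => biproduct.hom_ext' _ _ fun i => ?_
    simp only [toRep, biproduct.matrix_π, biproduct.ι_desc]
    exact FinInterval.toRep.map_preimage _

theorem exists_equiv {ι : Type} [Fintype ι] (X : ι → FinInterval n) :
    ∃ (m : Multiset (FinInterval n)) (e : m.ToType ≃ ι), ∀ k, X (e k) = summand k := by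
  classical
  let e₁ := (Finset.univ (α := ι)).val.mapEquiv X
  have hb : Function.Bijective (fun k : (Finset.univ (α := ι)).val.ToType => k.1) := by
    refine ⟨?_, fun i => ⟨⟨i, ⟨0, ?_⟩⟩, rfl⟩⟩
    · rintro ⟨i, a⟩ ⟨j, b⟩ (h : i = j)
      subst h
      have h1 := Multiset.count_eq_one_of_mem (Finset.univ (α := ι)).nodup (Finset.mem_univ i)
      congr 1
      apply Fin.ext
      have := a.2
      have := b.2
      omega
    · exact Multiset.count_pos.2 (Finset.mem_univ i)
  refine ⟨_, e₁.symm.trans (Equiv.ofBijective _ hb), fun k => ?_⟩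
  have h2 := Multiset.mapEquiv_apply (Finset.univ (α := ι)).val X (e₁.symm k)
  exact h2.symm.trans (congrArg Sigma.fst (e₁.apply_symm_apply k))

instance : (toRep (n := n)).EssSurj where
  mem_essImage M := by
    obtain ⟨ι, _, X, u, s, h1, h2, h3⟩ := exists_decomp _ M le_rfl
    obtain ⟨m, e, he⟩ := exists_equiv X
    have h4 : ∀ k, ∃ (u' : FinInterval.toRep.obj (summand k) ⟶ M) (s' : M ⟶ FinInterval.toRep.obj (summand k)), u' ≫ s' = 𝟙 _ ∧
        (∀ i (_ : i ≠ e k), u i ≫ s' = 0) ∧ s' ≫ u' = s (e k) ≫ u (e k) := by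
      intro k
      rw [← he k]
      exact ⟨u (e k), s (e k), h1 _, fun i hi => h2 _ _ hi, rfl⟩
    choose u' s' hus hz hsu using h4
    have hz' : ∀ j k, j ≠ k → u' j ≫ s' k = 0 := by
      intro j k hjk
      have : u' j = (u' j ≫ s (e j)) ≫ u (e j) := by
        rw [Category.assoc, ← hsu, ← Category.assoc, hus, Category.id_comp]
      rw [this, Category.assoc, hz k _ (fun h => hjk (e.injective h)), comp_zero]
    refine ⟨m, ⟨(⟨biproduct.desc u', biproduct.lift s', ?_, ?_⟩ : sumRep m ≅ M)⟩⟩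
    · refine biproduct.hom_ext _ _ fun j => biproduct.hom_ext' _ _ fun i => ?_
      by_cases hij : i = j
      · subst hij
        simp [hus]
      · simp [hz' _ _ hij, biproduct.ι_π_ne _ hij]
    · rw [biproduct.lift_desc]
      simp only [hsu]
      rw [← h3]
      exact e.sum_comp (fun i => s i ≫ u i)

instance : (toRep (n := n)).IsEquivalence where

instance : HasFiniteProducts (IntervalMultiset n) :=
  ⟨fun _ => Adjunction.hasLimitsOfShape_of_equivalence (toRep (n := n))⟩

noncomputable instance : Abelian (IntervalMultiset n) := abelianOfEquivalence (toRep (n := n))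

instance : HasExt.{0} (IntervalMultiset n) := HasExt.standard _

/-- An interval, regarded as a one-element multiset. -/
def ofInterval (x : FinInterval n) : IntervalMultiset n := ({x} : Multiset (FinInterval n))

/-- The object `[a,b]`. By convention it is zero (the empty multiset) when `[a,b]` is not an
interval of type `n`, in particular `[b+1,b] = 0`. -/
def ofEndpoints (n a b : ℕ) : IntervalMultiset n :=
  if h : 1 ≤ a ∧ a ≤ b ∧ b ≤ n then ofInterval ⟨a, b, h.1, h.2.1, h.2.2⟩
  else (0 : Multiset (FinInterval n))

end IntervalMultiset

/-! Under the equivalence with contravariant representations of a chain, `[1,b]` is free on one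
generator at the vertex `b`, hence projective. For `1 < a'` the interval `[a',b']` therefore has the
projective resolution `0 → [1,a'-1] → [1,b'] → [a',b'] → 0`, and `Ext¹([a',b'],[a,b])` is the
cokernel of `Hom([1,b'],[a,b]) → Hom([1,a'-1],[a,b])`. The target has at most one non-zero element,
present exactly when `a ≤ a'-1 ≤ b`, and that element factors through `[1,b']` exactly when `b' ≤
b`. This yields uniqueness and the necessity of the three inequalities
(`exists_extClass_of_ne_zero`).

Conversely, under these inequalities the sequence with middle term `[a,b'] ⊕ [a',b]` is exact
(`shortExact_allOnes`). It does not split, since neither summand admits a non-zero morphism back to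
`[a,b]` (`extClass_allOnes_ne_zero`).

The resolution is the case `[a,b] = [1,a'-1]` of the same sequence, where the second summand
`[a',a'-1]` vanishes. One exactness proof thus serves both purposes, once empty intervals are
treated on the same footing as the others; this is the role of `HasEndpoints`. -/

/-! ### Matrix entries over 𝔽₂ -/

namespace IntervalMultiset
open FinInterval
variable {n : ℕ}

/-- The scalar in `𝔽₂` underlying the entry of a morphism at `(i, j)`. -/
noncomputable def entry {m m' : IntervalMultiset n} (f : m ⟶ m') (i : Multiset.ToType m)
    (j : Multiset.ToType m') : ZMod 2 :=
  coef (x := summand i) (y := summand j) (f.hom i j)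

theorem entry_ext {m m' : IntervalMultiset n} {f g : m ⟶ m'}
    (h : ∀ i j, entry f i j = entry g i j) : f = g :=
  InducedCategory.hom_ext (Mat_.hom_ext _ _ fun i j => coef_ext (h i j))

theorem entry_zero {m m' : IntervalMultiset n} (i j) : entry (0 : m ⟶ m') i j = 0 := rfl

theorem coef_sum {x y : FinInterval n} {ι : Type*} (s : Finset ι) (f : ι → (x ⟶ y)) :
    coef (∑ k ∈ s, f k) = ∑ k ∈ s, coef (f k) :=
  map_sum (AddMonoidHom.mk' (coef (x := x) (y := y)) coef_add) f s

/-- Whether a composite is truncated to zero depends only on its source and target, so the condition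
comes out of the sum. -/
theorem entry_comp {m m' m'' : IntervalMultiset n} (f : m ⟶ m') (g : m' ⟶ m'') (i j) :
    entry (f ≫ g) i j =
      if (summand i).HomCond (summand j) then ∑ k, entry f i k * entry g k j else 0 := by
  have h : entry (f ≫ g) i j =
      coef (∑ k, (f.hom i k : summand i ⟶ summand k) ≫ (g.hom k j : summand k ⟶ summand j)) := rfl
  rw [h, coef_sum]
  split_ifs with hij
  · exact Finset.sum_congr rfl fun k _ => (coef_comp _ _).trans (if_pos hij)
  · exact Finset.sum_eq_zero fun k _ => (coef_comp _ _).trans (if_neg hij)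

theorem homCond_of_entry_ne_zero {m m' : IntervalMultiset n} {f : m ⟶ m'} {i j}
    (h : entry f i j ≠ 0) : (summand i).HomCond (summand j) :=
  coef_ne_zero h

theorem exists_entry_eq {m m' : IntervalMultiset n}
    (φ : Multiset.ToType m → Multiset.ToType m' → ZMod 2)
    (hφ : ∀ i j, φ i j ≠ 0 → (summand i).HomCond (summand j)) :
    ∃ f : m ⟶ m', ∀ i j, entry f i j = φ i j :=
  ⟨InducedCategory.homMk fun i j => (⟨φ i j, hφ i j⟩ : line _), fun _ _ => rfl⟩

/-- The morphism all of whose entries are non-zero wherever possible. -/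
noncomputable def allOnes (m m' : IntervalMultiset n) : m ⟶ m' :=
  (exists_entry_eq (m := m) (m' := m')
    (fun i j => if (summand i).HomCond (summand j) then 1 else 0)
    fun i j h => by by_contra h'; simp [h'] at h).choose

theorem entry_allOnes (m m' : IntervalMultiset n) (i j) :
    entry (allOnes m m') i j = if (summand i).HomCond (summand j) then 1 else 0 :=
  (exists_entry_eq (m := m) (m' := m')
    (fun i j => if (summand i).HomCond (summand j) then 1 else 0)
    fun i j h => by by_contra h'; simp [h'] at h).choose_spec i j

/-- The object `m` is the interval `[p,q]`, or zero if `q < p`. -/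
structure HasEndpoints (m : IntervalMultiset n) (p q : ℕ) : Prop where
  subsingleton : Subsingleton (Multiset.ToType m)
  nonempty : p ≤ q → Nonempty (Multiset.ToType m)
  summand_a (k : Multiset.ToType m) : (summand k).a = p
  summand_b (k : Multiset.ToType m) : (summand k).b = q

theorem hasEndpoints_ofInterval (x : FinInterval n) : HasEndpoints (ofInterval x) x.a x.b := by
  have h1 : ∀ k : Multiset.ToType ({x} : Multiset (FinInterval n)), k.1 = x := fun k =>
    Multiset.mem_singleton.1 (Multiset.count_pos.1 (Fin.pos k.2))
  have hcard : Fintype.card (Multiset.ToType ({x} : Multiset (FinInterval n))) = 1 := by simp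
  refine ⟨?_, fun _ => ?_, fun k => congrArg _ (h1 k), fun k => congrArg _ (h1 k)⟩
  · exact Fintype.card_le_one_iff_subsingleton.1 hcard.le
  · exact Fintype.card_pos_iff.1 (hcard ▸ one_pos)

/-- The bounds on `p` and `q` ensure that the default value zero occurs only for `q < p`. -/
theorem hasEndpoints_ofEndpoints {p q : ℕ} (hp : 1 ≤ p) (hq : q ≤ n) :
    HasEndpoints (ofEndpoints n p q) p q := by
  unfold ofEndpoints
  split_ifs with h
  · exact hasEndpoints_ofInterval ⟨p, q, h.1, h.2.1, h.2.2⟩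
  · have : IsEmpty (Multiset.ToType (0 : Multiset (FinInterval n))) :=
      Fintype.card_eq_zero_iff.1 (by simp)
    exact ⟨(inferInstance : Subsingleton (Multiset.ToType (0 : Multiset (FinInterval n)))),
      fun h' => absurd ⟨hp, h', hq⟩ h, fun k => isEmptyElim k, fun k => isEmptyElim k⟩

/-! ### Morphisms between intervals, possibly empty -/

section
variable {m m' : IntervalMultiset n} {p q p' q' : ℕ}

/-- The single column of a matrix whose target is an interval or zero. -/
noncomputable def col (f : m ⟶ m') (i : Multiset.ToType m) : ZMod 2 := ∑ j, entry f i j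

theorem HasEndpoints.le (h : HasEndpoints m p q) (k : Multiset.ToType m) : p ≤ q := by
  rw [← h.summand_a k, ← h.summand_b k]; exact (summand k).a_le_b

theorem HasEndpoints.homCond_iff (h : HasEndpoints m p q) (k : Multiset.ToType m)
    (y : FinInterval n) : y.HomCond (summand k) ↔ y.a ≤ p ∧ p ≤ y.b ∧ y.b ≤ q := by
  unfold HomCond; rw [h.summand_a, h.summand_b]

theorem HasEndpoints.homCond_iff' (h : HasEndpoints m p q) (k : Multiset.ToType m)
    (y : FinInterval n) : (summand k).HomCond y ↔ p ≤ y.a ∧ y.a ≤ q ∧ q ≤ y.b := by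
  unfold HomCond; rw [h.summand_a, h.summand_b]

theorem HasEndpoints.sum_eq (h : HasEndpoints m p q) (k : Multiset.ToType m)
    (φ : Multiset.ToType m → ZMod 2) : ∑ j, φ j = φ k := by
  have := h.subsingleton
  exact Fintype.sum_subsingleton φ k

/-- The sum defining `col` has at most one term. Unlike an entry, it also makes sense for the zero
object, where it is 0. -/
theorem col_eq_entry (h : HasEndpoints m' p q) (f : m ⟶ m') (i j) : col f i = entry f i j :=
  h.sum_eq j _

theorem col_zero (i) : col (0 : m ⟶ m') i = 0 := Finset.sum_eq_zero fun _ _ => rfl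

theorem col_add (f g : m ⟶ m') (i) : col (f + g) i = col f i + col g i :=
  Finset.sum_add_distrib

theorem HasEndpoints.col_ext (h : HasEndpoints m' p q) {f g : m ⟶ m'}
    (hfg : ∀ i, col f i = col g i) : f = g :=
  entry_ext fun i j => by rw [← col_eq_entry h, ← col_eq_entry h, hfg]

theorem HasEndpoints.of_col_ne_zero (h : HasEndpoints m' p q) {f : m ⟶ m'} {i}
    (hf : col f i ≠ 0) : (summand i).a ≤ p ∧ p ≤ (summand i).b ∧ (summand i).b ≤ q := by
  obtain ⟨j, -, hj⟩ := Finset.exists_ne_zero_of_sum_ne_zero hf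
  exact (h.homCond_iff j _).1 (homCond_of_entry_ne_zero hj)

theorem HasEndpoints.exists_col_eq (h : HasEndpoints m' p q) (φ : Multiset.ToType m → ZMod 2)
    (hφ : ∀ i, φ i ≠ 0 → (summand i).a ≤ p ∧ p ≤ (summand i).b ∧ (summand i).b ≤ q) :
    ∃ f : m ⟶ m', ∀ i, col f i = φ i := by
  obtain ⟨f, hf⟩ := exists_entry_eq (m := m) (m' := m') (fun i _ => φ i)
    fun i j hi => (h.homCond_iff j _).2 (hφ i hi)
  refine ⟨f, fun i => ?_⟩
  by_cases hi : φ i = 0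
  · exact (Finset.sum_eq_zero fun j _ => (hf i j).trans hi).trans hi.symm
  · have := hφ i hi
    obtain ⟨j⟩ := h.nonempty (this.2.1.trans this.2.2)
    rw [col_eq_entry h f i j, hf]

theorem col_comp_allOnes {m'' : IntervalMultiset n} (h : HasEndpoints m' p q)
    (h' : HasEndpoints m'' p' q') (hp : p ≤ p') (hq : q ≤ q')
    (hpq : p ≤ q → p' ≤ q' → p' ≤ q) (f : m ⟶ m') (i) :
    col (f ≫ allOnes m' m'') i =
      if (summand i).a ≤ p' ∧ p' ≤ (summand i).b ∧ (summand i).b ≤ q' then col f i else 0 := by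
  by_cases hne : p' ≤ q'
  · obtain ⟨l⟩ := h'.nonempty hne
    rw [col_eq_entry h' _ _ l, entry_comp]
    refine if_congr (h'.homCond_iff l _) (Finset.sum_congr rfl fun k _ => ?_) rfl
    rw [entry_allOnes, if_pos, mul_one]
    rw [h.homCond_iff' k, h'.summand_a, h'.summand_b]
    exact ⟨hp, hpq (h.le k) hne, hq⟩
  · rw [if_neg (by omega)]
    by_contra h0
    have := h'.of_col_ne_zero h0
    omega

/-- With a common left end, every row allowed into `[p,q]` is still allowed into `[p,q']`, so
nothing is erased. -/
theorem mono_allOnes (h : HasEndpoints m p q) (h' : HasEndpoints m' p q') (hq : q ≤ q') :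
    Mono (allOnes m m') := by
  refine Preadditive.mono_of_cancel_zero _ fun {l} f hf => h.col_ext fun i => ?_
  have h1 := congrArg (fun t => col t i) hf
  simp only [col_comp_allOnes h h' le_rfl hq (fun h _ => h), col_zero] at h1
  by_contra h0
  rw [col_zero] at h0
  have h2 := h.of_col_ne_zero h0
  exact h0 ((if_pos ⟨h2.1, h2.2.1, h2.2.2.trans hq⟩).symm.trans h1)

/-- Dually, with a common right end, any interval reached from `[p',q]` is also reached from
`[p,q]`, so a non-zero entry survives precomposition. -/
theorem epi_allOnes (h : HasEndpoints m p q) (h' : HasEndpoints m' p' q) (hp : p ≤ p') :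
    Epi (allOnes m m') := by
  refine Preadditive.epi_of_cancel_zero _ fun {l} f hf => entry_ext fun k j => ?_
  rw [entry_zero]
  by_contra h0
  have h2 := (h'.homCond_iff' k _).1 (homCond_of_entry_ne_zero h0)
  have h3 := h'.le k
  obtain ⟨i⟩ := h.nonempty (hp.trans h3)
  have h1 := congrArg (fun t => entry t i j) hf
  simp only [entry_comp, entry_zero] at h1
  rw [if_pos ((h.homCond_iff' i _).2 ⟨hp.trans h2.1, h2.2⟩), h'.sum_eq k, entry_allOnes, if_pos,
    one_mul] at h1
  · exact h0 h1
  · rw [h.homCond_iff' i, h'.summand_a, h'.summand_b]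
    exact ⟨hp, h3, le_rfl⟩

theorem eq_or_eq_zero_of_hom (h : HasEndpoints m p q) (h' : HasEndpoints m' p' q') (f : m ⟶ m') :
    f = 0 ∨ (f = allOnes m m' ∧ p ≤ p' ∧ p' ≤ q ∧ q ≤ q') := by
  by_cases h0 : f = 0
  · exact Or.inl h0
  obtain ⟨i, j, hij⟩ : ∃ i j, entry f i j ≠ 0 := by
    by_contra! hc
    exact h0 (entry_ext hc)
  have hc := homCond_of_entry_ne_zero hij
  refine Or.inr ⟨entry_ext fun i' j' => ?_, ?_⟩
  · have := h.subsingleton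
    have := h'.subsingleton
    -- The only non-zero scalar of 𝔽₂ is 1; the uniqueness of the extension class rests on this.
    rw [Subsingleton.elim i' i, Subsingleton.elim j' j, entry_allOnes, if_pos hc]
    generalize entry f i j = r at hij ⊢
    revert r
    decide
  · rwa [h'.homCond_iff, h.summand_a, h.summand_b] at hc

/-! ### The short exact sequence -/

variable {X A B X' : IntervalMultiset n} {a b a' b' : ℕ}

/-- The two paths from `X` to `X'` agree, and in characteristic 2 no sign is needed for their sum to
vanish. -/
theorem lift_comp_desc_allOnes (hX : HasEndpoints X a b) (hA : HasEndpoints A a b')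
    (hB : HasEndpoints B a' b) (hX' : HasEndpoints X' a' b') (ha : a < a') (hb : b < b') :
    biprod.lift (allOnes X A) (allOnes X B) ≫ biprod.desc (allOnes A X') (allOnes B X') = 0 := by
  have key : allOnes X A ≫ allOnes A X' = allOnes X B ≫ allOnes B X' := by
    refine hX'.col_ext fun i => ?_
    have h1 : ∀ {m : IntervalMultiset n}, allOnes X m = 𝟙 X ≫ allOnes X m := fun {m} =>
      (Category.id_comp _).symm
    rw [h1, h1 (m := B), col_comp_allOnes hA hX' ha.le le_rfl (fun _ h => h),
      col_comp_allOnes hB hX' le_rfl hb.le (fun h _ => h),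
      col_comp_allOnes hX hA le_rfl hb.le (fun h _ => h),
      col_comp_allOnes hX hB ha.le le_rfl (fun _ h => h)]
    have := hX.summand_a i
    have := hX.summand_b i
    have := (summand i).a_le_b
    split_ifs <;> first | rfl | omega
  rw [biprod.lift_desc, key, ← two_nsmul]
  refine hX'.col_ext fun i => ?_
  rw [two_nsmul, col_add, col_zero, CharTwo.add_self_eq_zero]

/-- Mono and epi are already visible on the component `A`. For exactness, a morphism `(u, v)` killed
by the second map is lifted to `X` row by row. -/
theorem shortExact_allOnes (hX : HasEndpoints X a b) (hA : HasEndpoints A a b')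
    (hB : HasEndpoints B a' b) (hX' : HasEndpoints X' a' b') (ha : a < a') (hb : b < b')
    (hab : a' ≤ b + 1) :
    (ShortComplex.mk (biprod.lift (allOnes X A) (allOnes X B))
      (biprod.desc (allOnes A X') (allOnes B X'))
      (lift_comp_desc_allOnes hX hA hB hX' ha hb)).ShortExact where
  mono_f := by
    have := mono_allOnes hX hA hb.le
    have : Mono (biprod.lift (allOnes X A) (allOnes X B) ≫ biprod.fst) := by
      rwa [biprod.lift_fst]
    exact mono_of_mono _ biprod.fst
  epi_g := by
    have := epi_allOnes hA hX' ha.le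
    have : Epi (biprod.inl ≫ biprod.desc (allOnes A X') (allOnes B X')) := by
      rwa [biprod.inl_desc]
    exact epi_of_epi biprod.inl _
  exact := by
    rw [ShortComplex.exact_iff_exact_up_to_refinements]
    intro m t ht
    have hu := fun i => hA.of_col_ne_zero (f := t ≫ biprod.fst) (i := i)
    have hv := fun i => hB.of_col_ne_zero (f := t ≫ biprod.snd) (i := i)
    have htuv : t = biprod.lift (t ≫ biprod.fst) (t ≫ biprod.snd) := by
      apply biprod.hom_ext <;> simp
    set u : m ⟶ A := t ≫ biprod.fst
    set v : m ⟶ B := t ≫ biprod.snd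
    have hs : u ≫ allOnes A X' + v ≫ allOnes B X' = 0 := by
      rw [← biprod.lift_desc, ← htuv]; exact ht
    have hcol : ∀ i, (summand i).a ≤ a' ∧ a' ≤ (summand i).b ∧ (summand i).b ≤ b' →
        col u i = col v i := fun i hi => by
      have h1 := congrArg (fun t => col t i) hs
      simp only [col_add, col_zero] at h1
      rw [col_comp_allOnes hA hX' ha.le le_rfl (fun _ h => h),
        col_comp_allOnes hB hX' le_rfl hb.le (fun h _ => h), if_pos hi, if_pos hi] at h1
      exact CharTwo.add_eq_zero.1 h1
    -- The lift copies `u` on the rows where a non-zero morphism to `[a,b]` exists.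
    obtain ⟨s, hs⟩ := hX.exists_col_eq (m := m)
      (fun i => if (summand i).a ≤ a ∧ a ≤ (summand i).b ∧ (summand i).b ≤ b then col u i else 0)
      fun i hi => by by_contra h; simp [h] at hi
    refine ⟨m, 𝟙 m, inferInstance, s, ?_⟩
    rw [Category.id_comp]
    refine htuv.trans (biprod.hom_ext _ _ ?_ ?_)
    · rw [Category.assoc, biprod.lift_fst, biprod.lift_fst]
      refine hA.col_ext fun i => ?_
      rw [col_comp_allOnes hX hA le_rfl hb.le (fun h _ => h), hs]
      split_ifs with h1 h2
      · rfl
      -- Here the right end of the row exceeds `b`, so it is at least `a'` by `a' ≤ b + 1`. Then `u`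
      -- and `v` agree on this row, but `v` cannot be non-zero there.
      · by_contra h0
        have h3 := hu i h0
        rw [hcol i (by omega)] at h0
        have h4 := hv i h0
        omega
      · by_contra h0
        exact h1 (hu i h0)
    · rw [Category.assoc, biprod.lift_snd, biprod.lift_snd]
      refine hB.col_ext fun i => ?_
      rw [col_comp_allOnes hX hB ha.le le_rfl (fun _ h => h), hs]
      have := (summand i).a_le_b
      split_ifs with h1
      · exact (hcol i (by omega)).symm
      · by_contra h0
        have h3 := hv i h0
        rw [← hcol i (by omega)] at h0
        have h4 := hu i h0
        omega
      · by_contra h0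
        exact h1 (hv i h0)
end

end IntervalMultiset

/-! ### Projectivity of the intervals `[1,b]` -/

namespace FinInterval
variable {n : ℕ}

theorem lin_surjective_of_epi {M N : ChainRep n} (e : M ⟶ N) [Epi e] (k : (Fin n)ᵒᵖ) :
    Function.Surjective (lin e k) := by
  have h1 : Epi (e.app k) := (NatTrans.epi_iff_epi_app e).1 inferInstance k
  have h2 : Epi ((forget₂ (FGModuleCat.{0} (ZMod 2)) (ModuleCat.{0} (ZMod 2))).map (e.app k)) :=
    inferInstance
  exact (ModuleCat.epi_iff_surjective _).1 h2

/-- The interval representations of the intervals `[1,b]` are projective. -/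
theorem projective_toRep (x : FinInterval n) (hx : x.a = 1) : Projective (toRep.obj x) where
  factors {M N} f e he := by
    have hb : 1 ≤ x.b := x.one_le.trans x.a_le_b
    have hmem : ∀ k : (Fin n)ᵒᵖ, x.Mem k.unop ↔ k.unop ≤ (vert x.b hb x.b_le).unop := fun k => by
      rw [Fin.le_def, vert_val]; unfold Mem; omega
    generalize vert x.b hb x.b_le = k₀ at hmem
    let one : line (x.Mem k₀.unop) := ⟨1, fun _ => (hmem k₀).2 le_rfl⟩
    -- The element 1 at the vertex `b` generates the representation freely, so a lift amounts to a
    -- preimage `v` of its image, spread along the structure maps.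
    obtain ⟨v, hv⟩ := lin_surjective_of_epi e k₀ (lin f k₀ one)
    let w : ∀ k, M.obj k := fun k =>
      if h : k.unop ≤ k₀.unop then str M (arr h) v else 0
    have hw : ∀ {k} (h : k.unop ≤ k₀.unop), w k = str M (arr h) v := fun h => dif_pos h
    let φ : toRep.obj x ⟶ M := mkHom
      (fun k => LinearMap.toSpanSingleton (ZMod 2) (M.obj k) (w k) ∘ₗ
        (line (x.Mem k.unop)).subtype) (by
      intro k l g
      apply LinearMap.ext
      intro (r : line (x.Mem k.unop))
      change (scal (x.Mem k.unop) (x.Mem l.unop) 1 r).1 • w l = str M g (r.1 • w k)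
      rw [scal_coe, one_mul, map_smul]
      by_cases hk : x.Mem k.unop
      · have hl : x.Mem l.unop := (hmem l).2 ((leOfHom g.unop).trans ((hmem k).1 hk))
        rw [if_pos hl, hw ((hmem k).1 hk), hw ((hmem l).1 hl)]
        congr 1
        exact LinearMap.congr_fun (str_comp M (arr ((hmem k).1 hk)) g) v
      · simp [line_eq_zero hk])
    refine ⟨φ, lin_ext fun k => LinearMap.ext fun (r : line (x.Mem k.unop)) => ?_⟩
    change lin e k (r.1 • w k) = lin f k r
    by_cases hk : x.Mem k.unop
    · have h1 : r = r.1 • str (toRep.obj x) (arr ((hmem k).1 hk)) one := by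
        apply Subtype.ext
        change r.1 = r.1 • (scal (x.Mem k₀.unop) (x.Mem k.unop) 1 one).1
        rw [scal_coe, if_pos hk, mul_one]
        exact (mul_one _).symm
      have h2 := LinearMap.congr_fun (lin_naturality e (arr ((hmem k).1 hk))) v
      have h3 := LinearMap.congr_fun (lin_naturality f (arr ((hmem k).1 hk))) one
      have h4 : lin f k r = r.1 • lin f k (str (toRep.obj x) (arr ((hmem k).1 hk)) one) :=
        (congrArg (lin f k) h1).trans (map_smul (lin f k) _ _)
      rw [map_smul, hw ((hmem k).1 hk), h4]
      congr 1
      refine h2.trans (Eq.trans ?_ h3.symm)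
      exact congrArg (str N (arr ((hmem k).1 hk))) hv
    · have h1 : r = 0 := Subtype.ext (line_eq_zero hk r)
      rw [h1]
      refine Eq.trans ?_ (map_zero (lin f k)).symm
      change lin e k ((0 : ZMod 2) • w k) = 0
      rw [zero_smul, map_zero]

end FinInterval

/-! ### Computation of `Ext¹` -/

namespace IntervalMultiset
open FinInterval Abelian
variable {n : ℕ}

theorem projective_of_summand_a_eq_one (m : IntervalMultiset n)
    (hm : ∀ k : Multiset.ToType m, (summand k).a = 1) : Projective m := by
  have h1 : ∀ k : Multiset.ToType m, Projective (FinInterval.toRep.obj (summand k)) := fun k =>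
    projective_toRep _ (hm k)
  have h2 : Projective (toRep.asEquivalence.functor.obj m) :=
    inferInstanceAs (Projective (⨁ fun k : Multiset.ToType m =>
      FinInterval.toRep.obj (summand k)))
  exact (toRep.asEquivalence.map_projective_iff m).1 h2

theorem allOnes_comp_allOnes {m m' m'' : IntervalMultiset n} {p q p' q' p'' q'' : ℕ}
    (h : HasEndpoints m p q) (h' : HasEndpoints m' p' q') (h'' : HasEndpoints m'' p'' q'')
    (h1 : p ≤ p' ∧ p' ≤ q ∧ q ≤ q') (h2 : p' ≤ p'' ∧ p'' ≤ q' ∧ q' ≤ q'') (h3 : p'' ≤ q) :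
    allOnes m m' ≫ allOnes m' m'' = allOnes m m'' := by
  refine entry_ext fun i j => ?_
  obtain ⟨k⟩ := h'.nonempty (h1.2.1.trans (h1.2.2))
  rw [entry_comp, h'.sum_eq k]
  simp only [entry_allOnes]
  simp only [h'.homCond_iff, h''.homCond_iff, h.summand_a, h.summand_b, h'.summand_a, h'.summand_b]
  rw [if_pos (by omega), if_pos h1, if_pos h2, if_pos (by omega), one_mul]

section
variable {X A B X' : IntervalMultiset n} {a b a' b' : ℕ}

/-- The connecting map sends the identity of `S.X₁` to the extension class; if that is zero, the
identity extends to `S.X₂`. -/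
theorem extClass_ne_zero_of_no_retraction {S : ShortComplex (IntervalMultiset n)}
    (hS : S.ShortExact) (h : ∀ r : S.X₂ ⟶ S.X₁, S.f ≫ r ≠ 𝟙 _) : hS.extClass ≠ 0 := by
  intro h0
  obtain ⟨r, hr⟩ := Ext.contravariant_sequence_exact₁ hS S.X₁ (Ext.mk₀ (𝟙 S.X₁)) (n₁ := 1) rfl
    (by rw [h0, Ext.zero_comp])
  obtain ⟨r, rfl⟩ := Ext.addEquiv₀.symm.surjective r
  apply h r
  apply Ext.addEquiv₀.symm.injective
  simpa using hr

/-- A retraction would be zero: `b < b'` excludes morphisms `[a,b'] → [a,b]`, and `a < a'` excludes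
morphisms `[a',b] → [a,b]`. -/
theorem extClass_allOnes_ne_zero (hX : HasEndpoints X a b) (hA : HasEndpoints A a b')
    (hB : HasEndpoints B a' b) (hX' : HasEndpoints X' a' b') (ha : a < a') (hb : b < b')
    (hab : a' ≤ b + 1) (hne : a ≤ b) :
    (shortExact_allOnes hX hA hB hX' ha hb hab).extClass ≠ 0 := by
  refine extClass_ne_zero_of_no_retraction _ fun (r : A ⊞ B ⟶ X) hr => ?_
  have h1 : biprod.inl ≫ r = 0 :=
    (eq_or_eq_zero_of_hom hA hX _).resolve_right fun h => by omega
  have h2 : biprod.inr ≫ r = 0 :=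
    (eq_or_eq_zero_of_hom hB hX _).resolve_right fun h => by omega
  have h3 : r = 0 := biprod.hom_ext' _ _ (by rw [h1, comp_zero]) (by rw [h2, comp_zero])
  rw [h3, comp_zero] at hr
  obtain ⟨i⟩ := hX.nonempty hne
  have h4 := congrArg (fun t => entry t i i) hr
  have h5 : entry (𝟙 X) i i = 1 := by
    have h6 : (𝟙 (toMat X) : _ ⟶ _) i i = 𝟙 _ := Mat_.id_apply_self _ _
    exact congrArg coef h6
  exact zero_ne_one ((entry_zero (m := X) (m' := X) i i).symm.trans (h4.trans h5))

/-- A non-zero extension class of intervals is unique, and forces the two intervals to be linked. -/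
theorem exists_extClass_of_ne_zero (hX : HasEndpoints X a b) (hX' : HasEndpoints X' a' b')
    (ha' : 1 ≤ a') (hab' : a' ≤ b') (hbn : b' ≤ n) :
    ∃ η₀ : Ext X' X 1, ∀ η : Ext X' X 1, η ≠ 0 →
      η = η₀ ∧ a < a' ∧ b < b' ∧ a' ≤ b + 1 := by
  obtain rfl | h1 := ha'.eq_or_lt
  -- For `a' = 1` the interval is projective and there is no non-zero class.
  · have := projective_of_summand_a_eq_one X' hX'.summand_a
    exact ⟨0, fun η hη => absurd (Ext.eq_zero_of_projective η) hη⟩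
  have hP := hasEndpoints_ofEndpoints (n := n) (p := 1) (q := a' - 1) le_rfl (by omega)
  have hQ := hasEndpoints_ofEndpoints (n := n) (p := 1) (q := b') le_rfl hbn
  have hZ := hasEndpoints_ofEndpoints (n := n) (p := a') (q := a' - 1) ha' (by omega)
  have := projective_of_summand_a_eq_one _ hQ.summand_a
  -- `[a',a'-1]` has no summands, so the condition on left ends is vacuous.
  have := projective_of_summand_a_eq_one (ofEndpoints n a' (a' - 1)) fun k => by
    have := hZ.le k
    omega
  have hS := shortExact_allOnes hP hQ hZ hX' h1 (by omega) (by omega)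
  refine ⟨hS.extClass.comp (Ext.mk₀ (allOnes _ X)) rfl, fun η hη => ?_⟩
  -- The middle term is projective, so every class comes from a morphism `[1,a'-1] → X` through the
  -- connecting map.
  obtain ⟨ξ, hξ⟩ := Ext.contravariant_sequence_exact₃ hS X η (Ext.eq_zero_of_projective _)
    (n₀ := 0) rfl
  obtain ⟨φ, rfl⟩ := Ext.addEquiv₀.symm.surjective ξ
  change hS.extClass.comp (Ext.mk₀ φ) _ = η at hξ
  obtain rfl | ⟨rfl, h2, h3, h4⟩ := eq_or_eq_zero_of_hom hP hX φ
  · rw [Ext.mk₀_zero, Ext.comp_zero] at hξ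
    exact absurd hξ.symm hη
  refine ⟨hξ.symm, by omega, ?_, by omega⟩
  -- If `b' ≤ b`, the morphism `[1,a'-1] → X` factors through `[1,b']`, so the connecting map kills
  -- it.
  by_contra hb
  apply hη
  have h5 : allOnes (ofEndpoints n 1 (a' - 1)) X = biprod.lift (allOnes _ _) (allOnes _ _) ≫
      (biprod.fst : ofEndpoints n 1 b' ⊞ ofEndpoints n a' (a' - 1) ⟶ _) ≫ allOnes _ X := by
    rw [biprod.lift_fst_assoc]
    exact (allOnes_comp_allOnes hP hQ hX (by omega) (by omega) (by omega)).symm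
  rw [← hξ, h5, ← Ext.mk₀_comp_mk₀]
  exact hS.extClass_comp_assoc _
end

end IntervalMultiset

theorem mainTheorem8 (n : ℕ) (x x' : FinInterval n) :
    ((∃ η : Abelian.Ext (IntervalMultiset.ofInterval x') (IntervalMultiset.ofInterval x) 1, η ≠ 0) ↔
      x.a < x'.a ∧ x.b < x'.b ∧ x'.a ≤ x.b + 1) ∧
    (x.a < x'.a ∧ x.b < x'.b ∧ x'.a ≤ x.b + 1 →
      ∃ η : Abelian.Ext (IntervalMultiset.ofInterval x') (IntervalMultiset.ofInterval x) 1,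
        η ≠ 0 ∧ (∀ θ, θ ≠ 0 → θ = η) ∧
        ∃ (f : IntervalMultiset.ofInterval x ⟶
              IntervalMultiset.ofEndpoints n x.a x'.b ⊞ IntervalMultiset.ofEndpoints n x'.a x.b)
          (g : IntervalMultiset.ofEndpoints n x.a x'.b ⊞ IntervalMultiset.ofEndpoints n x'.a x.b ⟶
              IntervalMultiset.ofInterval x')
          (w : f ≫ g = 0) (hS : (ShortComplex.mk f g w).ShortExact), hS.extClass = η) := by
  have hx := IntervalMultiset.hasEndpoints_ofInterval x
  have hx' := IntervalMultiset.hasEndpoints_ofInterval x'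
  have hA := IntervalMultiset.hasEndpoints_ofEndpoints x.one_le x'.b_le
  have hB := IntervalMultiset.hasEndpoints_ofEndpoints x'.one_le x.b_le
  obtain ⟨η₀, hη₀⟩ :=
    IntervalMultiset.exists_extClass_of_ne_zero hx hx' x'.one_le x'.a_le_b x'.b_le
  have key (h : x.a < x'.a ∧ x.b < x'.b ∧ x'.a ≤ x.b + 1) :=
    IntervalMultiset.extClass_allOnes_ne_zero hx hA hB hx' h.1 h.2.1 h.2.2 x.a_le_b
  exact ⟨⟨fun ⟨η, hη⟩ => (hη₀ η hη).2, fun h => ⟨_, key h⟩⟩,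
    -- Every non-zero class equals `η₀`, so any two of them coincide.
    fun h => ⟨_, key h, fun θ hθ => (hη₀ θ hθ).1.trans (hη₀ _ (key h)).1.symm,
      _, _, _, _, rfl⟩⟩
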